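/- Let $n\ge 1$ and let $\Omega\subset\mathbb{C}^n$ be a Reinhardt domain, bounded or not, i.e. a nonempty connected open set such that $(\lambda_1z_1,\dots,\lambda_nz_n)\in\Omega$ whenever $z\in\Omega$ and $|\lambda_1|=\dots=|\lambda_n|=1$. Let $\mathcal{A}^\infty(\Omega)$ be the space of holomorphic functions $f$ on $\Omega$ all of whose derivatives $D^\beta f=\partial^{\beta_1+\dots+\beta_n}f/\partial z_1^{\beta_1}\cdots\partial z_n^{\beta_n}$, $\beta\in\mathbb{N}^n$, extend continuously to $\overline{\Omega}$, with the locally convex (Fréchet) topology generated by the seminorms $$\|f\|_{k,\Omega_m}=\sup\{|D^\beta f(z)| : z\in\Omega_m,\ \beta_1+\dots+\beta_n\le k\},\qquad \Omega_m=\{z\in\Omega : |z_j|<m \text{ for all } j\},\qquad k,m\in\mathbb{N}.$$ Let $f\in\mathcal{A}^\infty(\Omega)$. Then the Laurent series $\sum_{\alpha\in\mathbb{Z}^n}c_\alpha z^\alpha$ of $f$, whose coefficients are $$c_\alpha=\frac{1}{(2\pi i)^n}\int_{|\zeta_1|=|w_1|}\cdots\int_{|\zeta_n|=|w_n|}\frac{f(\zeta)}{\zeta^\alpha}\,\frac{d\zeta_n}{\zeta_n}\cdots\frac{d\zeta_1}{\zeta_1}$$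 for every $w\in\Omega$ with $w_1\cdots w_n\ne 0$ (independently of $w$), has all its terms in $\mathcal{A}^\infty(\Omega)$ and converges unconditionally to $f$ in the topology of $\mathcal{A}^\infty(\Omega)$: for every bijection $\sigma:\mathbb{N}\to\mathbb{Z}^n$, the partial sums of $\sum_{j=0}^\infty c_{\sigma(j)}z^{\sigma(j)}$ converge to $f$ in $\mathcal{A}^\infty(\Omega)$. Moreover, the series converges absolutely in $\mathcal{A}^\infty(\Omega)$: there is a bijection $\sigma:\mathbb{N}\to\mathbb{Z}^n$ such that $\sum_{j=0}^\infty p(c_{\sigma(j)}z^{\sigma(j)})<\infty$ for every continuous seminorm $p$ on $\mathcal{A}^\infty(\Omega)$. -/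

import Mathlib

open Filter Topology

noncomputable section

namespace LaurentAInfty

/-- A Reinhardt domain in `ℂⁿ`: a (nonempty) open connected set that is invariant under the
rotations `z ↦ (lam₁ z₁, …, lamₙ zₙ)`, `|lamⱼ| = 1`. -/
structure IsReinhardtDomain {n : ℕ} (Ω : Set (Fin n → ℂ)) : Prop where
  isOpen : IsOpen Ω
  isConnected : IsConnected Ω
  rotate_mem : ∀ z ∈ Ω, ∀ lam : Fin n → ℂ, (∀ j, ‖lam j‖ = 1) → (fun j => lam j * z j) ∈ Ω

/-- The partial derivative `∂g/∂zⱼ`. -/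
def pderiv {n : ℕ} (j : Fin n) (g : (Fin n → ℂ) → ℂ) : (Fin n → ℂ) → ℂ :=
  fun z => fderiv ℂ g z (Pi.single j 1)

/-- `(∂/∂z_{j₁})^{α_{j₁}} (∂/∂z_{j₂})^{α_{j₂}} ⋯ g`, for a list `j₁, j₂, …` of variables. -/
def mderivList {n : ℕ} (α : Fin n → ℕ) (l : List (Fin n)) (g : (Fin n → ℂ) → ℂ) :
    (Fin n → ℂ) → ℂ :=
  l.foldr (fun j h => (pderiv j)^[α j] h) g

/-- `D^α g = ∂^{α₁ + ⋯ + αₙ} g / ∂z₁^{α₁} ⋯ ∂zₙ^{αₙ}`. -/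
def mderiv {n : ℕ} (α : Fin n → ℕ) (g : (Fin n → ℂ) → ℂ) : (Fin n → ℂ) → ℂ :=
  mderivList α (List.finRange n) g

/-- Extension by zero of a function on `Ω` to `ℂⁿ`. On an open `Ω`, its values and derivatives
at the points of `Ω` are those of the function. -/
def zeroExt {n : ℕ} {Ω : Set (Fin n → ℂ)} (f : Ω → ℂ) : (Fin n → ℂ) → ℂ :=
  Function.extend Subtype.val f 0

theorem zeroExt_apply {n : ℕ} {Ω : Set (Fin n → ℂ)} (f : Ω → ℂ) (z : Ω) :
    zeroExt f z = f z :=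
  Subtype.val_injective.extend_apply f 0 z

theorem zeroExt_of_notMem {n : ℕ} {Ω : Set (Fin n → ℂ)} (f : Ω → ℂ) {z : Fin n → ℂ}
    (hz : z ∉ Ω) : zeroExt f z = 0 := by
  unfold zeroExt
  rw [Function.extend_apply']
  · rfl
  · rintro ⟨a, rfl⟩
    exact hz a.2

theorem zeroExt_add {n : ℕ} {Ω : Set (Fin n → ℂ)} (f g : Ω → ℂ) :
    zeroExt (f + g) = zeroExt f + zeroExt g := by
  ext z
  by_cases hz : z ∈ Ω
  · have h := zeroExt_apply (f + g) ⟨z, hz⟩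
    have hf := zeroExt_apply f ⟨z, hz⟩
    have hg := zeroExt_apply g ⟨z, hz⟩
    simp only [Pi.add_apply] at *
    rw [h, hf, hg]
  · simp [zeroExt_of_notMem _ hz]

theorem zeroExt_smul {n : ℕ} {Ω : Set (Fin n → ℂ)} (a : ℂ) (f : Ω → ℂ) :
    zeroExt (a • f) = a • zeroExt f := by
  ext z
  by_cases hz : z ∈ Ω
  · have h := zeroExt_apply (a • f) ⟨z, hz⟩
    have hf := zeroExt_apply f ⟨z, hz⟩
    simp only [Pi.smul_apply] at *
    rw [h, hf]
  · simp [zeroExt_of_notMem _ hz]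

theorem zeroExt_zero {n : ℕ} {Ω : Set (Fin n → ℂ)} : zeroExt (0 : Ω → ℂ) = 0 := by
  have h := zeroExt_smul (0 : ℂ) (0 : Ω → ℂ)
  simpa using h

/-! Linearity of `D^α` on analytic functions. -/

theorem analyticAt_pderiv {n : ℕ} (j : Fin n) {g : (Fin n → ℂ) → ℂ} {z : Fin n → ℂ}
    (hg : AnalyticAt ℂ g z) : AnalyticAt ℂ (pderiv j g) z :=
  ((ContinuousLinearMap.apply ℂ ℂ (Pi.single j 1 : Fin n → ℂ)).analyticAt _).comp hg.fderiv

theorem analyticAt_pderiv_iterate {n : ℕ} (j : Fin n) (k : ℕ) {g : (Fin n → ℂ) → ℂ}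
    {z : Fin n → ℂ} (hg : AnalyticAt ℂ g z) : AnalyticAt ℂ ((pderiv j)^[k] g) z := by
  induction k with
  | zero => exact hg
  | succ k ih =>
    rw [Function.iterate_succ_apply']
    exact analyticAt_pderiv j ih

theorem analyticAt_mderivList {n : ℕ} (α : Fin n → ℕ) (l : List (Fin n))
    {g : (Fin n → ℂ) → ℂ} {z : Fin n → ℂ} (hg : AnalyticAt ℂ g z) :
    AnalyticAt ℂ (mderivList α l g) z := by
  induction l with
  | nil => exact hg
  | cons j l ih => exact analyticAt_pderiv_iterate j (α j) ih

theorem analyticAt_mderiv {n : ℕ} (α : Fin n → ℕ) {g : (Fin n → ℂ) → ℂ} {z : Fin n → ℂ}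
    (hg : AnalyticAt ℂ g z) : AnalyticAt ℂ (mderiv α g) z :=
  analyticAt_mderivList α _ hg

theorem pderiv_congr {n : ℕ} (j : Fin n) {g h : (Fin n → ℂ) → ℂ} {z : Fin n → ℂ}
    (hgh : g =ᶠ[𝓝 z] h) : pderiv j g =ᶠ[𝓝 z] pderiv j h := by
  filter_upwards [hgh.fderiv (𝕜 := ℂ)] with w hw
  simp only [pderiv, hw]

theorem pderiv_linear {n : ℕ} (j : Fin n) (a : ℂ) {g h : (Fin n → ℂ) → ℂ} {z : Fin n → ℂ}
    (hg : AnalyticAt ℂ g z) (hh : AnalyticAt ℂ h z) :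
    pderiv j (g + a • h) =ᶠ[𝓝 z] pderiv j g + a • pderiv j h := by
  filter_upwards [hg.eventually_analyticAt, hh.eventually_analyticAt] with w hgw hhw
  simp only [pderiv, Pi.add_apply, Pi.smul_apply]
  rw [fderiv_add hgw.differentiableAt (hhw.differentiableAt.const_smul a),
    fderiv_const_smul hhw.differentiableAt]
  rfl

theorem pderiv_iterate_linear {n : ℕ} (j : Fin n) (k : ℕ) (a : ℂ)
    {f g h : (Fin n → ℂ) → ℂ} {z : Fin n → ℂ}
    (hg : AnalyticAt ℂ g z) (hh : AnalyticAt ℂ h z) (hf : f =ᶠ[𝓝 z] g + a • h) :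
    (pderiv j)^[k] f =ᶠ[𝓝 z] (pderiv j)^[k] g + a • (pderiv j)^[k] h := by
  induction k with
  | zero => exact hf
  | succ k ih =>
    simp only [Function.iterate_succ_apply']
    exact (pderiv_congr j ih).trans (pderiv_linear j a
      (analyticAt_pderiv_iterate j k hg) (analyticAt_pderiv_iterate j k hh))

theorem mderivList_linear {n : ℕ} (α : Fin n → ℕ) (l : List (Fin n)) (a : ℂ)
    {g h : (Fin n → ℂ) → ℂ} {z : Fin n → ℂ}
    (hg : AnalyticAt ℂ g z) (hh : AnalyticAt ℂ h z) :
    mderivList α l (g + a • h) =ᶠ[𝓝 z] mderivList α l g + a • mderivList α l h := by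
  induction l with
  | nil => exact EventuallyEq.rfl
  | cons j l ih =>
    exact pderiv_iterate_linear j (α j) a (analyticAt_mderivList α l hg)
      (analyticAt_mderivList α l hh) ih

theorem mderiv_linear {n : ℕ} (α : Fin n → ℕ) (a : ℂ) {g h : (Fin n → ℂ) → ℂ}
    {z : Fin n → ℂ} (hg : AnalyticAt ℂ g z) (hh : AnalyticAt ℂ h z) :
    mderiv α (g + a • h) z = mderiv α g z + a * mderiv α h z :=
  (mderivList_linear α _ a hg hh).eq_of_nhds

theorem mderiv_add {n : ℕ} (α : Fin n → ℕ) {g h : (Fin n → ℂ) → ℂ}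
    {z : Fin n → ℂ} (hg : AnalyticAt ℂ g z) (hh : AnalyticAt ℂ h z) :
    mderiv α (g + h) z = mderiv α g z + mderiv α h z := by
  simpa using mderiv_linear α 1 hg hh

theorem mderiv_zero {n : ℕ} (α : Fin n → ℕ) (z : Fin n → ℂ) :
    mderiv α (0 : (Fin n → ℂ) → ℂ) z = 0 := by
  have h0 : AnalyticAt ℂ (0 : (Fin n → ℂ) → ℂ) z := analyticAt_const
  simpa using mderiv_add α h0 h0

theorem mderiv_smul {n : ℕ} (α : Fin n → ℕ) (a : ℂ) {h : (Fin n → ℂ) → ℂ}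
    {z : Fin n → ℂ} (hh : AnalyticAt ℂ h z) :
    mderiv α (a • h) z = a * mderiv α h z := by
  have h0 : AnalyticAt ℂ (0 : (Fin n → ℂ) → ℂ) z := analyticAt_const
  simpa [mderiv_zero] using mderiv_linear α a h0 hh

/-- `f : Ω → ℂ` is holomorphic and each of its derivatives `D^α f` extends continuously to the
closure of `Ω`. -/
structure IsAInfty {n : ℕ} (Ω : Set (Fin n → ℂ)) (f : Ω → ℂ) : Prop where
  holo : AnalyticOnNhd ℂ (zeroExt f) Ω
  ext : ∀ α : Fin n → ℕ, ∃ g : (Fin n → ℂ) → ℂ,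
    ContinuousOn g (closure Ω) ∧ ∀ z ∈ Ω, g z = mderiv α (zeroExt f) z

/-- The functions holomorphic on `Ω` and smooth up to the boundary, as a linear subspace of all
functions on `Ω`. -/
def aInftySubmodule {n : ℕ} (Ω : Set (Fin n → ℂ)) : Submodule ℂ (Ω → ℂ) where
  carrier := {f | IsAInfty Ω f}
  zero_mem' := by
    refine ⟨?_, fun α => ⟨0, continuousOn_const, fun z _ => ?_⟩⟩
    · rw [zeroExt_zero]
      exact fun z _ => analyticAt_const
    · rw [zeroExt_zero, mderiv_zero]
      rfl
  add_mem' := by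
    rintro f g hf hg
    refine ⟨?_, fun α => ?_⟩
    · rw [zeroExt_add]
      exact hf.holo.add hg.holo
    · obtain ⟨u, hu, hu'⟩ := hf.ext α
      obtain ⟨v, hv, hv'⟩ := hg.ext α
      refine ⟨u + v, hu.add hv, fun z hz => ?_⟩
      rw [zeroExt_add, mderiv_add α (hf.holo z hz) (hg.holo z hz), ← hu' z hz, ← hv' z hz]
      rfl
  smul_mem' := by
    rintro a f hf
    refine ⟨?_, fun α => ?_⟩
    · rw [zeroExt_smul]
      exact fun z hz => analyticAt_const.smul (hf.holo z hz)
    · obtain ⟨u, hu, hu'⟩ := hf.ext α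
      refine ⟨a • u, hu.const_smul a, fun z hz => ?_⟩
      rw [zeroExt_smul, mderiv_smul α a (hf.holo z hz), ← hu' z hz]
      rfl

/-- The space `𝒜^∞(Ω)` of holomorphic functions on `Ω` smooth up to the boundary. It is a type of
its own, so that it does not inherit the topology of pointwise convergence. -/
def AInfty {n : ℕ} (Ω : Set (Fin n → ℂ)) : Type := aInftySubmodule Ω

namespace AInfty

instance {n : ℕ} (Ω : Set (Fin n → ℂ)) : AddCommGroup (AInfty Ω) :=
  inferInstanceAs (AddCommGroup (aInftySubmodule Ω))

instance {n : ℕ} (Ω : Set (Fin n → ℂ)) : Module ℂ (AInfty Ω) :=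
  inferInstanceAs (Module ℂ (aInftySubmodule Ω))

/-- The underlying function on `Ω`. -/
def toFun {n : ℕ} {Ω : Set (Fin n → ℂ)} (f : AInfty Ω) : Ω → ℂ := f.1

instance {n : ℕ} (Ω : Set (Fin n → ℂ)) : CoeFun (AInfty Ω) (fun _ => Ω → ℂ) := ⟨toFun⟩

theorem isAInfty {n : ℕ} {Ω : Set (Fin n → ℂ)} (f : AInfty Ω) : IsAInfty Ω f := f.2

theorem toFun_add {n : ℕ} {Ω : Set (Fin n → ℂ)} (f g : AInfty Ω) :
    (f + g).toFun = f.toFun + g.toFun := rfl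

theorem toFun_smul {n : ℕ} {Ω : Set (Fin n → ℂ)} (a : ℂ) (f : AInfty Ω) :
    (a • f).toFun = a • f.toFun := rfl

end AInfty

/-- The polydisc `P_m = {z : |zⱼ| < m for all j}`. -/
def polydisc (n m : ℕ) : Set (Fin n → ℂ) := {z | ∀ j, ‖z j‖ < m}

/-- The indices of the supremum below: a multi-index of length at most `k` and a point of
`Ω_m = Ω ∩ P_m`. -/
abbrev SupIndex {n : ℕ} (Ω : Set (Fin n → ℂ)) (k m : ℕ) : Type :=
  {α : Fin n → ℕ // ∑ j, α j ≤ k} × ↥(Ω ∩ polydisc n m)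

/-- `‖f‖_{k, Ω_m} = sup {|D^α f(z)| : z ∈ Ω ∩ P_m, α₁ + ⋯ + αₙ ≤ k}`. -/
def ckNorm {n : ℕ} {Ω : Set (Fin n → ℂ)} (k m : ℕ) (f : AInfty Ω) : ℝ :=
  ⨆ p : SupIndex Ω k m, ‖mderiv p.1.1 (zeroExt f.toFun) p.2.1‖

/-- The supremum is taken over a bounded set. -/
theorem bddAbove_ckNorm {n : ℕ} {Ω : Set (Fin n → ℂ)} (k m : ℕ) (f : AInfty Ω) :
    BddAbove (Set.range fun p : SupIndex Ω k m =>
      ‖mderiv p.1.1 (zeroExt f.toFun) p.2.1‖) := by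
  have hfin : Finite {α : Fin n → ℕ // ∑ j, α j ≤ k} := by
    refine Set.Finite.subset (Set.finite_Iic (fun _ : Fin n => k)) ?_
    intro α hα j
    exact (Finset.single_le_sum (f := α) (fun _ _ => Nat.zero_le _) (Finset.mem_univ j)).trans hα
  have hα : ∀ α : {α : Fin n → ℕ // ∑ j, α j ≤ k}, ∃ C : ℝ, ∀ z ∈ Ω ∩ polydisc n m,
      ‖mderiv α.1 (zeroExt f.toFun) z‖ ≤ C := by
    intro α
    obtain ⟨g, hg, hg'⟩ := f.isAInfty.ext α.1
    have hK : IsCompact (closure Ω ∩ Metric.closedBall (0 : Fin n → ℂ) m) :=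
      (isCompact_closedBall _ _).inter_left isClosed_closure
    obtain ⟨C, hC⟩ := hK.exists_bound_of_continuousOn (hg.mono Set.inter_subset_left)
    refine ⟨C, fun z hz => ?_⟩
    rw [← hg' z hz.1]
    refine hC z ⟨subset_closure hz.1, ?_⟩
    rw [mem_closedBall_zero_iff, pi_norm_le_iff_of_nonneg (Nat.cast_nonneg m)]
    exact fun j => (hz.2 j).le
  choose C hC using hα
  obtain ⟨B, hB⟩ := (Set.finite_range C).bddAbove
  refine ⟨B, ?_⟩
  rintro _ ⟨p, rfl⟩
  exact (hC p.1 p.2.1 p.2.2).trans (hB ⟨p.1, rfl⟩)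

/-- `‖·‖_{k, Ω_m}` as a seminorm on `𝒜^∞(Ω)`. -/
def ckSeminorm {n : ℕ} (Ω : Set (Fin n → ℂ)) (k m : ℕ) : Seminorm ℂ (AInfty Ω) :=
  Seminorm.of (ckNorm k m)
    (by
      intro f g
      refine Real.iSup_le (fun p => ?_)
        (add_nonneg (Real.iSup_nonneg fun _ => norm_nonneg _)
          (Real.iSup_nonneg fun _ => norm_nonneg _))
      rw [AInfty.toFun_add, zeroExt_add,
        mderiv_add _ (f.isAInfty.holo _ p.2.2.1) (g.isAInfty.holo _ p.2.2.1)]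
      exact (norm_add_le _ _).trans
        (add_le_add (le_ciSup (bddAbove_ckNorm k m f) p) (le_ciSup (bddAbove_ckNorm k m g) p)))
    (by
      intro a f
      unfold ckNorm
      rw [Real.mul_iSup_of_nonneg (norm_nonneg a)]
      refine iSup_congr fun p => ?_
      rw [AInfty.toFun_smul, zeroExt_smul, mderiv_smul _ a (f.isAInfty.holo _ p.2.2.1), norm_mul])

/-- The family of seminorms `‖·‖_{k, Ω_m}`, `k, m ∈ ℕ`. -/
def ckFamily {n : ℕ} (Ω : Set (Fin n → ℂ)) : SeminormFamily ℂ (AInfty Ω) (ℕ × ℕ) :=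
  fun p => ckSeminorm Ω p.1 p.2

/-- The Fréchet topology of `𝒜^∞(Ω)`: the locally convex topology generated by the seminorms
`‖·‖_{k, Ω_m}`, `k, m ∈ ℕ`. -/
instance {n : ℕ} (Ω : Set (Fin n → ℂ)) : TopologicalSpace (AInfty Ω) :=
  (ckFamily Ω).moduleFilterBasis.topology

theorem withSeminorms_ckFamily {n : ℕ} (Ω : Set (Fin n → ℂ)) : WithSeminorms (ckFamily Ω) :=
  ⟨rfl⟩

/-- A formal series `∑_{a ∈ Γ} x_a` is absolutely convergent: for some bijection `σ : ℕ → Γ`, the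
series `∑ⱼ p(x_{σ(j)})` converges for every continuous seminorm `p`. -/
def AbsolutelyConvergent {Γ X : Type*} [AddCommGroup X] [Module ℂ X] [TopologicalSpace X]
    (x : Γ → X) : Prop :=
  ∃ σ : ℕ ≃ Γ, ∀ p : Seminorm ℂ X, Continuous p → Summable fun j => p (x (σ j))

/-- A formal series `∑_{a ∈ Γ} x_a` converges unconditionally to `s`: for every bijection
`σ : ℕ → Γ`, the partial sums of `∑ⱼ x_{σ(j)}` converge to `s`. -/
def UnconditionallyConvergesTo {Γ X : Type*} [AddCommGroup X] [TopologicalSpace X]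
    (x : Γ → X) (s : X) : Prop :=
  ∀ σ : ℕ ≃ Γ, Tendsto (fun N => ∑ j ∈ Finset.range N, x (σ j)) atTop (𝓝 s)

/-- The Laurent coefficient of `f` of exponent `α`, by the Cauchy formula on the torus
`|ζⱼ| = |wⱼ|` through a point `w`:
`(2πi)⁻ⁿ ∫ f(ζ) ζ^{-α} dζ₁/ζ₁ ⋯ dζₙ/ζₙ`. -/
def laurentCoeff {n : ℕ} {Ω : Set (Fin n → ℂ)} (f : Ω → ℂ) (w : Fin n → ℂ)
    (α : Fin n → ℤ) : ℂ :=
  ((2 * (Real.pi : ℂ) * Complex.I) ^ n)⁻¹ *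
    torusIntegral (fun ζ => zeroExt f ζ / ∏ j, ζ j ^ (α j + 1)) 0 (fun j => ‖w j‖)

end LaurentAInfty

end

/-!
The torus acts on a Reinhardt domain by rotations of the coordinates, and the Fourier coefficient
of exponent `α` of `t ↦ f (t • z)` is a function of `z` which is homogeneous of multidegree `α`.
Euler's identity `zⱼ ∂F/∂zⱼ = αⱼ F` and the identity theorem show that such a function `F` is a
multiple of `z ^ α`; in polar coordinates the factor is the Cauchy integral defining the Laurent
coefficient. Taking a homogeneous component commutes with `∂/∂zⱼ` up to a shift of the exponent,
so Euler's identity also bounds `|αⱼ|` times a component of `f` by `|zⱼ|` times a component of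
`∂f/∂zⱼ`. Iterating, the components of every `D^β f` decay faster than any power of `‖α‖`,
uniformly on `Ω_m`. This gives absolute convergence, and Fourier inversion on each orbit identifies
the sum.
-/

noncomputable section

namespace LaurentAInfty

open MeasureTheory UnitAddTorus

variable {n : ℕ} {Ω : Set (Fin n → ℂ)}

/-! ### Partial derivatives -/

theorem pderiv_eqOn (hΩ : IsOpen Ω) (j : Fin n) {g h : (Fin n → ℂ) → ℂ} (hgh : Set.EqOn g h Ω) :
    Set.EqOn (pderiv j g) (pderiv j h) Ω :=
  fun _ hz => (pderiv_congr j (hgh.eventuallyEq_of_mem (hΩ.mem_nhds hz))).eq_of_nhds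

theorem pderiv_iterate_eqOn (hΩ : IsOpen Ω) (j : Fin n) (k : ℕ) {g h : (Fin n → ℂ) → ℂ}
    (hgh : Set.EqOn g h Ω) : Set.EqOn ((pderiv j)^[k] g) ((pderiv j)^[k] h) Ω := by
  induction k with
  | zero => exact hgh
  | succ k ih =>
    simp only [Function.iterate_succ_apply']
    exact pderiv_eqOn hΩ j ih

theorem mderivList_eqOn (hΩ : IsOpen Ω) (β : Fin n → ℕ) (l : List (Fin n))
    {g h : (Fin n → ℂ) → ℂ} (hgh : Set.EqOn g h Ω) :
    Set.EqOn (mderivList β l g) (mderivList β l h) Ω := by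
  induction l with
  | nil => exact hgh
  | cons j l ih => exact pderiv_iterate_eqOn hΩ j (β j) ih

theorem mderiv_eqOn (hΩ : IsOpen Ω) (β : Fin n → ℕ) {g h : (Fin n → ℂ) → ℂ}
    (hgh : Set.EqOn g h Ω) : Set.EqOn (mderiv β g) (mderiv β h) Ω :=
  mderivList_eqOn hΩ β _ hgh

theorem pderiv_pderiv (i j : Fin n) {g : (Fin n → ℂ) → ℂ} {z : Fin n → ℂ}
    (hg : DifferentiableAt ℂ (fderiv ℂ g) z) :
    pderiv i (pderiv j g) z = fderiv ℂ (fderiv ℂ g) z (Pi.single i 1) (Pi.single j 1) := by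
  unfold pderiv
  rw [fderiv_clm_apply hg (differentiableAt_const _)]
  simp

theorem pderiv_comm (i j : Fin n) {g : (Fin n → ℂ) → ℂ} {z : Fin n → ℂ}
    (hg : AnalyticAt ℂ g z) : pderiv i (pderiv j g) z = pderiv j (pderiv i g) z := by
  have hd : DifferentiableAt ℂ (fderiv ℂ g) z := hg.fderiv.differentiableAt
  rw [pderiv_pderiv i j hd, pderiv_pderiv j i hd]
  exact (hg.contDiffAt (n := ⊤)).isSymmSndFDerivAt (by simp) _ _

theorem pderiv_iterate_comm (hΩ : IsOpen Ω) (i j : Fin n) (k : ℕ) {g : (Fin n → ℂ) → ℂ}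
    (hg : AnalyticOnNhd ℂ g Ω) :
    Set.EqOn (pderiv i ((pderiv j)^[k] g)) ((pderiv j)^[k] (pderiv i g)) Ω := by
  induction k with
  | zero => exact Set.eqOn_refl _ _
  | succ k ih =>
    simp only [Function.iterate_succ_apply']
    have hcomm : Set.EqOn (pderiv i (pderiv j ((pderiv j)^[k] g)))
        (pderiv j (pderiv i ((pderiv j)^[k] g))) Ω :=
      fun z hz => pderiv_comm i j (analyticAt_pderiv_iterate j k (hg z hz))
    exact hcomm.trans (pderiv_eqOn hΩ j ih)

theorem mderivList_add_single_of_notMem (β : Fin n → ℕ) {i : Fin n} {l : List (Fin n)}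
    (hi : i ∉ l) (g : (Fin n → ℂ) → ℂ) :
    mderivList (β + Pi.single i 1) l g = mderivList β l g := by
  refine List.foldr_ext _ _ _ fun j hj h => ?_
  have hji : j ≠ i := fun hji => hi (hji ▸ hj)
  simp [hji]

theorem pderiv_mderivList (hΩ : IsOpen Ω) (β : Fin n → ℕ) (i : Fin n) {l : List (Fin n)}
    (hl : l.Nodup) (hi : i ∈ l) {g : (Fin n → ℂ) → ℂ} (hg : AnalyticOnNhd ℂ g Ω) :
    Set.EqOn (pderiv i (mderivList β l g)) (mderivList (β + Pi.single i 1) l g) Ω := by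
  induction l with
  | nil => simp at hi
  | cons j l ih =>
    obtain ⟨hjl, hl⟩ := List.nodup_cons.1 hl
    have hcons : ∀ γ, mderivList γ (j :: l) g = (pderiv j)^[γ j] (mderivList γ l g) := fun _ => rfl
    rw [hcons, hcons]
    by_cases hij : i = j
    · subst hij
      rw [mderivList_add_single_of_notMem β hjl, Pi.add_apply, Pi.single_eq_same,
        Function.iterate_succ_apply']
      exact Set.eqOn_refl _ _
    · have hil : i ∈ l := (List.mem_cons.1 hi).resolve_left hij
      rw [Pi.add_apply, Pi.single_eq_of_ne (Ne.symm hij), add_zero]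
      exact (pderiv_iterate_comm hΩ i j (β j)
        fun z hz => analyticAt_mderivList β l (hg z hz)).trans
        (pderiv_iterate_eqOn hΩ j (β j) (ih hl hil))

theorem pderiv_mderiv (hΩ : IsOpen Ω) (β : Fin n → ℕ) (i : Fin n) {g : (Fin n → ℂ) → ℂ}
    (hg : AnalyticOnNhd ℂ g Ω) :
    Set.EqOn (pderiv i (mderiv β g)) (mderiv (β + Pi.single i 1) g) Ω :=
  pderiv_mderivList hΩ β i (List.nodup_finRange n) (List.mem_finRange i) hg

theorem zeroExt_eqOn (g : (Fin n → ℂ) → ℂ) : Set.EqOn (zeroExt fun z : Ω => g z) g Ω :=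
  fun z hz => zeroExt_apply (fun z : Ω => g z) ⟨z, hz⟩

/-! ### Rotations of the coordinates -/

attribute [local instance] instMeasureSpaceUnitAddCircle
attribute [local instance] instIsAddHaarMeasureUnitAddCircleVolume
attribute [local instance] instIsProbabilityMeasureUnitAddCircleVolume

/-- The action of the torus `(ℝ/ℤ)ⁿ` on `ℂⁿ` by rotations of the coordinates,
`(t • z)ⱼ = exp(2πi tⱼ) zⱼ`. -/
def rot (t : UnitAddTorus (Fin n)) : (Fin n → ℂ) →L[ℂ] (Fin n → ℂ) :=
  ContinuousLinearMap.pi fun j => (fourier 1 (t j) : ℂ) • ContinuousLinearMap.proj j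

theorem rot_apply (t : UnitAddTorus (Fin n)) (z : Fin n → ℂ) (j : Fin n) :
    rot t z j = fourier 1 (t j) * z j := rfl

theorem norm_rot_apply (t : UnitAddTorus (Fin n)) (z : Fin n → ℂ) (j : Fin n) :
    ‖rot t z j‖ = ‖z j‖ := by
  rw [rot_apply, norm_mul, fourier_apply, Circle.norm_coe, one_mul]

theorem continuous_rot : Continuous (rot (n := n)) := by
  refine continuous_clm_apply.2 fun z => continuous_pi fun j => ?_
  simp only [rot_apply]
  fun_prop

theorem continuous_rot_apply :
    Continuous fun p : (Fin n → ℂ) × UnitAddTorus (Fin n) => rot p.2 p.1 :=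
  (continuous_rot.comp continuous_snd).clm_apply continuous_fst

theorem rot_zero (z : Fin n → ℂ) : rot 0 z = z := by
  ext j
  simp [rot_apply]

theorem rot_add (s t : UnitAddTorus (Fin n)) (z : Fin n → ℂ) :
    rot (s + t) z = rot s (rot t z) := by
  ext j
  simp only [rot_apply, Pi.add_apply, fourier_apply, one_smul, AddCircle.toCircle_add,
    Circle.coe_mul, mul_assoc]

theorem rot_single (t : UnitAddTorus (Fin n)) (j : Fin n) :
    rot t (Pi.single j 1) = (fourier 1 (t j) : ℂ) • (Pi.single j 1 : Fin n → ℂ) := by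
  ext i
  obtain rfl | hij := eq_or_ne i j <;> simp [rot_apply, *]

theorem IsReinhardtDomain.mapsTo_rot (hΩ : IsReinhardtDomain Ω) (t : UnitAddTorus (Fin n)) :
    Set.MapsTo (rot t) Ω Ω := fun z hz =>
  hΩ.rotate_mem z hz _ fun j => by rw [fourier_apply, Circle.norm_coe]

theorem mapsTo_rot_polydisc (t : UnitAddTorus (Fin n)) (m : ℕ) :
    Set.MapsTo (rot t) (polydisc n m) (polydisc n m) := fun z hz j => by
  rw [norm_rot_apply]
  exact hz j

/-! ### Homogeneous components -/

theorem norm_mFourier_apply {d : Type*} [Fintype d] (α : d → ℤ) (t : UnitAddTorus d) :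
    ‖mFourier α t‖ = 1 := by
  simp only [mFourier, ContinuousMap.coe_mk, norm_prod, fourier_apply, Circle.norm_coe,
    Finset.prod_const_one]

theorem mFourier_add_right {d : Type*} [Fintype d] (α : d → ℤ) (s t : UnitAddTorus d) :
    mFourier α (s + t) = mFourier α s * mFourier α t := by
  simp only [mFourier, ContinuousMap.coe_mk, Pi.add_apply, ← Finset.prod_mul_distrib,
    fourier_apply, smul_add, AddCircle.toCircle_add, Circle.coe_mul]

theorem mFourier_mul_mFourier_neg {d : Type*} [Fintype d] (α : d → ℤ) (t : UnitAddTorus d) :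
    mFourier α t * mFourier (-α) t = 1 := by
  rw [← mFourier_add, add_neg_cancel, mFourier_zero, ContinuousMap.one_apply]

theorem mFourier_neg_mul_fourier_one {d : Type*} [Fintype d] [DecidableEq d] (α : d → ℤ) (j : d)
    (t : UnitAddTorus d) :
    mFourier (-α) t * fourier 1 (t j) = mFourier (-(α - Pi.single j 1)) t := by
  rw [← mFourier_single, ← mFourier_add, neg_sub, neg_add_eq_sub]

theorem mFourier_single_coe {d : Type*} [Fintype d] [DecidableEq d] (α : d → ℤ) (j : d) (θ : ℝ) :
    mFourier α (Pi.single j (θ : UnitAddCircle)) =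
      Complex.exp (2 * Real.pi * Complex.I * α j * θ) := by
  simp only [mFourier, ContinuousMap.coe_mk]
  rw [Finset.prod_eq_single j (fun i _ hij => by simp [hij]) (by simp), Pi.single_eq_same,
    fourier_coe_apply]
  simp

/-- The Fourier coefficient of exponent `α` of `t ↦ g (rot t z)`, as a function of `z`: the
homogeneous component of degree `α` of `g`. -/
def torusCoeff (g : (Fin n → ℂ) → ℂ) (α : Fin n → ℤ) (z : Fin n → ℂ) : ℂ :=
  mFourierCoeff (fun t => g (rot t z)) α

theorem torusCoeff_eq_integral (g : (Fin n → ℂ) → ℂ) (α : Fin n → ℤ) (z : Fin n → ℂ) :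
    torusCoeff g α z = ∫ t : UnitAddTorus (Fin n), mFourier (-α) t * g (rot t z) := rfl

theorem torusCoeff_congr {g h : (Fin n → ℂ) → ℂ} {z : Fin n → ℂ}
    (hgh : ∀ t, g (rot t z) = h (rot t z)) (α : Fin n → ℤ) :
    torusCoeff g α z = torusCoeff h α z := by
  simp only [torusCoeff, hgh]

theorem norm_torusCoeff_le {g : (Fin n → ℂ) → ℂ} {z : Fin n → ℂ} {C : ℝ}
    (hC : ∀ t, ‖g (rot t z)‖ ≤ C) (α : Fin n → ℤ) : ‖torusCoeff g α z‖ ≤ C := by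
  have hbound (t : UnitAddTorus (Fin n)) : ‖mFourier (-α) t * g (rot t z)‖ ≤ C := by
    rw [norm_mul, norm_mFourier_apply, one_mul]
    exact hC t
  simpa [torusCoeff_eq_integral] using
    norm_integral_le_of_norm_le_const (μ := volume) (Eventually.of_forall hbound)

theorem continuousOn_torusCoeff {S : Set (Fin n → ℂ)} (hS : ∀ t, Set.MapsTo (rot t) S S)
    {g : (Fin n → ℂ) → ℂ} (hg : ContinuousOn g S) (α : Fin n → ℤ) :
    ContinuousOn (torusCoeff g α) S := by
  refine continuousOn_integral_of_compact_support (k := Set.univ) isCompact_univ ?_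
    (fun p t _ ht => (ht (Set.mem_univ t)).elim)
  refine ContinuousOn.smul ((mFourier (-α)).continuous.comp continuous_snd).continuousOn ?_
  exact hg.comp continuous_rot_apply.continuousOn fun p hp => hS p.2 hp.1

theorem torusCoeff_rot (g : (Fin n → ℂ) → ℂ) (α : Fin n → ℤ) (z : Fin n → ℂ)
    (s : UnitAddTorus (Fin n)) :
    torusCoeff g α (rot s z) = mFourier α s * torusCoeff g α z := by
  have hint (t : UnitAddTorus (Fin n)) : mFourier (-α) t * g (rot t (rot s z)) =
      mFourier α s * (mFourier (-α) (t + s) * g (rot (t + s) z)) := by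
    rw [rot_add, mFourier_add_right]
    linear_combination (-mFourier (-α) t * g (rot t (rot s z))) * mFourier_mul_mFourier_neg α s
  simp only [torusCoeff_eq_integral, hint]
  rw [integral_const_mul,
    integral_add_right_eq_self (fun t => mFourier (-α) t * g (rot t z)) s]

/-! ### Derivatives of homogeneous components -/

theorem hasFDerivAt_integral_of_compactSpace {E X : Type*} [NormedAddCommGroup E]
    [NormedSpace ℂ E] [ProperSpace E] [TopologicalSpace X] [CompactSpace X] [MeasurableSpace X]
    [OpensMeasurableSpace X] {μ : Measure X} [IsFiniteMeasure μ] {U : Set E} (hU : IsOpen U)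
    {F : E → X → ℂ} {F' : E → X → E →L[ℂ] ℂ}
    (hF : ContinuousOn (Function.uncurry F) (U ×ˢ Set.univ))
    (hF' : ContinuousOn (Function.uncurry F') (U ×ˢ Set.univ))
    (hd : ∀ x ∈ U, ∀ t, HasFDerivAt (fun y => F y t) (F' x t) x) {x : E} (hx : x ∈ U) :
    Integrable (F' x) μ ∧ HasFDerivAt (fun y => ∫ t, F y t ∂μ) (∫ t, F' x t ∂μ) x := by
  obtain ⟨r, hr, hball⟩ := Metric.nhds_basis_closedBall.mem_iff.1 (hU.mem_nhds hx)
  have hintF : ∀ y ∈ U, Integrable (F y) μ := fun y hy =>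
    (continuousOn_univ.1 (hF.uncurry_left y hy)).integrable_of_hasCompactSupport
      (HasCompactSupport.of_compactSpace _)
  have hintF' : Integrable (F' x) μ :=
    (continuousOn_univ.1 (hF'.uncurry_left x hx)).integrable_of_hasCompactSupport
      (HasCompactSupport.of_compactSpace _)
  obtain ⟨C, hC⟩ := ((isCompact_closedBall x r).prod
    (isCompact_univ (X := X))).exists_bound_of_continuousOn
    (hF'.mono (Set.prod_mono hball subset_rfl))
  refine ⟨hintF', hasFDerivAt_integral_of_dominated_of_fderiv_le (bound := fun _ => C)
    (Metric.closedBall_mem_nhds x hr) ?_ (hintF x hx) hintF'.aestronglyMeasurable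
    (Eventually.of_forall fun t y hy => hC (y, t) ⟨hy, Set.mem_univ t⟩) (integrable_const C)
    (Eventually.of_forall fun t y hy => hd y (hball hy) t)⟩
  filter_upwards [hU.mem_nhds hx] with y hy using (hintF y hy).aestronglyMeasurable

theorem hasFDerivAt_torusCoeff (hΩ : IsOpen Ω) (hrot : ∀ t, Set.MapsTo (rot t) Ω Ω)
    {g : (Fin n → ℂ) → ℂ} (hg : AnalyticOnNhd ℂ g Ω) (α : Fin n → ℤ) {z : Fin n → ℂ}
    (hz : z ∈ Ω) :
    Integrable (fun t => mFourier (-α) t • (fderiv ℂ g (rot t z)).comp (rot t)) volume ∧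
    HasFDerivAt (torusCoeff g α)
      (∫ t, mFourier (-α) t • (fderiv ℂ g (rot t z)).comp (rot t)) z := by
  have hmaps : Set.MapsTo (fun p : (Fin n → ℂ) × UnitAddTorus (Fin n) => rot p.2 p.1)
      (Ω ×ˢ Set.univ) Ω := fun p hp => hrot p.2 hp.1
  have hm : Continuous fun p : (Fin n → ℂ) × UnitAddTorus (Fin n) => mFourier (-α) p.2 :=
    (mFourier (-α)).continuous.comp continuous_snd
  refine hasFDerivAt_integral_of_compactSpace (F := fun x t => mFourier (-α) t * g (rot t x))
    (F' := fun x t => mFourier (-α) t • (fderiv ℂ g (rot t x)).comp (rot t)) hΩ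
    (hm.continuousOn.mul (hg.continuousOn.comp continuous_rot_apply.continuousOn hmaps))
    (hm.continuousOn.smul (ContinuousOn.clm_comp
      (hg.fderiv.continuousOn.comp continuous_rot_apply.continuousOn hmaps)
      (continuous_rot.comp continuous_snd).continuousOn)) (fun x hx t => ?_) hz
  exact ((hg _ (hrot t hx)).differentiableAt.hasFDerivAt.comp x (rot t).hasFDerivAt).const_mul _

theorem pderiv_torusCoeff (hΩ : IsOpen Ω) (hrot : ∀ t, Set.MapsTo (rot t) Ω Ω)
    {g : (Fin n → ℂ) → ℂ} (hg : AnalyticOnNhd ℂ g Ω) (α : Fin n → ℤ) (j : Fin n) :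
    Set.EqOn (pderiv j (torusCoeff g α)) (torusCoeff (pderiv j g) (α - Pi.single j 1)) Ω := by
  intro z hz
  obtain ⟨hint, hderiv⟩ := hasFDerivAt_torusCoeff hΩ hrot hg α hz
  rw [pderiv, hderiv.fderiv, ContinuousLinearMap.integral_apply hint, torusCoeff_eq_integral]
  congr 1 with t
  simp only [smul_apply, ContinuousLinearMap.comp_apply, rot_single,
    map_smul, smul_eq_mul, pderiv, ← mFourier_neg_mul_fourier_one, mul_assoc]

theorem differentiableOn_torusCoeff (hΩ : IsOpen Ω) (hrot : ∀ t, Set.MapsTo (rot t) Ω Ω)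
    {g : (Fin n → ℂ) → ℂ} (hg : AnalyticOnNhd ℂ g Ω) (α : Fin n → ℤ) :
    DifferentiableOn ℂ (torusCoeff g α) Ω := fun _ hz =>
  (hasFDerivAt_torusCoeff hΩ hrot hg α hz).2.differentiableAt.differentiableWithinAt

theorem pderiv_iterate_torusCoeff (hΩ : IsOpen Ω) (hrot : ∀ t, Set.MapsTo (rot t) Ω Ω)
    {g : (Fin n → ℂ) → ℂ} (hg : AnalyticOnNhd ℂ g Ω) (α : Fin n → ℤ) (j : Fin n) (k : ℕ) :
    Set.EqOn ((pderiv j)^[k] (torusCoeff g α))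
      (torusCoeff ((pderiv j)^[k] g) (α - Pi.single j (k : ℤ))) Ω := by
  induction k with
  | zero => simp [Set.eqOn_refl]
  | succ k ih =>
    simp only [Function.iterate_succ_apply']
    rw [Nat.cast_succ, Pi.single_add, ← sub_sub]
    exact (pderiv_eqOn hΩ j ih).trans
      (pderiv_torusCoeff hΩ hrot (fun z hz => analyticAt_pderiv_iterate j k (hg z hz)) _ j)

theorem mderivList_torusCoeff (hΩ : IsOpen Ω) (hrot : ∀ t, Set.MapsTo (rot t) Ω Ω)
    {g : (Fin n → ℂ) → ℂ} (hg : AnalyticOnNhd ℂ g Ω) (α : Fin n → ℤ) (β : Fin n → ℕ)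
    (l : List (Fin n)) :
    Set.EqOn (mderivList β l (torusCoeff g α))
      (torusCoeff (mderivList β l g)
        (α - (l.map fun j => (Pi.single j (β j : ℤ) : Fin n → ℤ)).sum)) Ω := by
  induction l with
  | nil => simp [Set.eqOn_refl, mderivList]
  | cons j l ih =>
    rw [List.map_cons, List.sum_cons, add_comm, ← sub_sub]
    exact (pderiv_iterate_eqOn hΩ j (β j) ih).trans
      (pderiv_iterate_torusCoeff hΩ hrot (fun z hz => analyticAt_mderivList β l (hg z hz)) _ j _)

theorem mderiv_torusCoeff (hΩ : IsOpen Ω) (hrot : ∀ t, Set.MapsTo (rot t) Ω Ω)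
    {g : (Fin n → ℂ) → ℂ} (hg : AnalyticOnNhd ℂ g Ω) (α : Fin n → ℤ) (β : Fin n → ℕ) :
    Set.EqOn (mderiv β (torusCoeff g α)) (torusCoeff (mderiv β g) (α - fun j => (β j : ℤ))) Ω := by
  have h := mderivList_torusCoeff hΩ hrot hg α β (List.finRange n)
  rwa [← List.ofFn_eq_map, List.sum_ofFn, Finset.univ_sum_single (fun j => (β j : ℤ))] at h

/-! ### Euler's identity -/

theorem hasDerivAt_cexp_mul_ofReal (a : ℂ) :
    HasDerivAt (fun θ : ℝ => Complex.exp (a * θ)) a 0 := by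
  simpa using ((hasDerivAt_id (0 : ℝ)).ofReal_comp.const_mul a).cexp

theorem hasDerivAt_rot_single (z : Fin n → ℂ) (j : Fin n) :
    HasDerivAt (fun θ : ℝ => rot (Pi.single j (θ : UnitAddCircle)) z)
      ((2 * Real.pi * Complex.I * z j) • (Pi.single j 1 : Fin n → ℂ)) 0 := by
  refine hasDerivAt_pi.2 fun i => ?_
  simp only [rot_apply]
  obtain rfl | hij := eq_or_ne i j
  · simpa only [Pi.single_eq_same, fourier_coe_apply, Int.cast_one, mul_one, Complex.ofReal_one,
      div_one, Pi.smul_apply, smul_eq_mul] using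
      (hasDerivAt_cexp_mul_ofReal (2 * Real.pi * Complex.I)).mul_const (z i)
  · simpa [hij] using hasDerivAt_const (0 : ℝ) (z i)

theorem mul_pderiv_eq_of_forall_rot {F : (Fin n → ℂ) → ℂ} {z : Fin n → ℂ}
    (hF : DifferentiableAt ℂ F z) {α : Fin n → ℤ}
    (hrot : ∀ t, F (rot t z) = mFourier α t * F z) (j : Fin n) :
    z j * pderiv j F z = α j * F z := by
  have hrot0 : rot (Pi.single j ((0 : ℝ) : UnitAddCircle)) z = z := by
    rw [AddCircle.coe_zero, Pi.single_zero, rot_zero]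
  have hchain : HasDerivAt (fun θ : ℝ => F (rot (Pi.single j (θ : UnitAddCircle)) z))
      (2 * Real.pi * Complex.I * z j * pderiv j F z) 0 := by
    have h := (hF.hasFDerivAt.restrictScalars ℝ).comp_hasDerivAt_of_eq 0
      (hasDerivAt_rot_single z j) hrot0.symm
    rwa [ContinuousLinearMap.coe_restrictScalars', map_smul] at h
  have hexp : HasDerivAt (fun θ : ℝ => F (rot (Pi.single j (θ : UnitAddCircle)) z))
      (2 * Real.pi * Complex.I * α j * F z) 0 := by
    simp only [hrot, mFourier_single_coe]
    exact (hasDerivAt_cexp_mul_ofReal _).mul_const _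
  refine mul_left_cancel₀ Complex.two_pi_I_ne_zero ?_
  simpa only [mul_assoc] using hchain.unique hexp

/-! ### Homogeneous functions are monomials -/

/-- The Laurent monomial `z ^ α`. -/
def monomial (α : Fin n → ℤ) (z : Fin n → ℂ) : ℂ := ∏ j, z j ^ α j

/-- The points of `ℂⁿ` none of whose coordinates vanishes, where all Laurent monomials are
holomorphic and nonzero. -/
def nonzeroCoords (n : ℕ) : Set (Fin n → ℂ) := {z | ∀ j, z j ≠ 0}

theorem nonzeroCoords_eq_pi (n : ℕ) :
    nonzeroCoords n = Set.univ.pi fun _ : Fin n => ({0}ᶜ : Set ℂ) := by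
  ext z
  simp [nonzeroCoords]

theorem dense_nonzeroCoords (n : ℕ) : Dense (nonzeroCoords n) := by
  rw [nonzeroCoords_eq_pi]
  exact dense_pi _ fun j _ => dense_compl_singleton 0

theorem isOpen_nonzeroCoords (n : ℕ) : IsOpen (nonzeroCoords n) := by
  rw [nonzeroCoords_eq_pi]
  exact isOpen_set_pi Set.finite_univ fun j _ => isOpen_compl_singleton

theorem mapsTo_rot_nonzeroCoords (t : UnitAddTorus (Fin n)) :
    Set.MapsTo (rot t) (nonzeroCoords n) (nonzeroCoords n) := fun z hz j => by
  rw [← norm_ne_zero_iff, norm_rot_apply, norm_ne_zero_iff]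
  exact hz j

theorem monomial_ne_zero {α : Fin n → ℤ} {z : Fin n → ℂ} (hz : ∀ j, z j ≠ 0 ∨ α j = 0) :
    monomial α z ≠ 0 :=
  Finset.prod_ne_zero_iff.2 fun j _ => (hz j).elim (zpow_ne_zero _) fun h => by simp [h]

theorem monomial_eq_zero {α : Fin n → ℤ} {z : Fin n → ℂ} {j : Fin n} (hz : z j = 0)
    (hα : α j ≠ 0) : monomial α z = 0 :=
  Finset.prod_eq_zero (Finset.mem_univ j) (by rw [hz, zero_zpow _ hα])

theorem monomial_add {α β : Fin n → ℤ} {z : Fin n → ℂ} (hz : ∀ j, z j ≠ 0 ∨ 0 ≤ α j ∧ 0 ≤ β j) :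
    monomial (α + β) z = monomial α z * monomial β z := by
  rw [monomial, monomial, monomial, ← Finset.prod_mul_distrib]
  refine Finset.prod_congr rfl fun j _ => ?_
  rcases hz j with h | ⟨hα, hβ⟩
  · exact zpow_add₀ h _ _
  · exact zpow_add' (by lia)

theorem monomial_mul_monomial_neg (α : Fin n → ℤ) {z : Fin n → ℂ} (hz : z ∈ nonzeroCoords n) :
    monomial α z * monomial (-α) z = 1 := by
  rw [← monomial_add fun j => Or.inl (hz j), add_neg_cancel]
  simp [monomial]

theorem monomial_mul_monomial_negPart {α : Fin n → ℤ} {z : Fin n → ℂ}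
    (hz : ∀ j, z j ≠ 0 ∨ 0 ≤ α j) : monomial α z * monomial α⁻ z = monomial α⁺ z := by
  rw [← monomial_add fun j => (hz j).imp_right fun h => ⟨h, negPart_nonneg α j⟩,
    ← sub_eq_iff_eq_add.1 (posPart_sub_negPart α)]

theorem monomial_rot (α : Fin n → ℤ) (t : UnitAddTorus (Fin n)) (z : Fin n → ℂ) :
    monomial α (rot t z) = mFourier α t * monomial α z := by
  simp only [monomial, rot_apply, mul_zpow, Finset.prod_mul_distrib, mFourier,
    ContinuousMap.coe_mk, fourier_apply, one_smul, AddCircle.toCircle_zsmul, Circle.coe_zpow]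

theorem analyticAt_monomial {α : Fin n → ℤ} {z : Fin n → ℂ} (hz : ∀ j, z j ≠ 0 ∨ 0 ≤ α j) :
    AnalyticAt ℂ (monomial α) z := by
  refine Finset.analyticAt_fun_prod _ fun j _ => ?_
  have hproj : AnalyticAt ℂ (fun w : Fin n → ℂ => w j) z :=
    (ContinuousLinearMap.proj (R := ℂ) (φ := fun _ : Fin n => ℂ) j).analyticAt z
  exact (hz j).elim hproj.zpow hproj.zpow_nonneg

theorem eqOn_zero_of_convex_of_eventuallyEq_zero {E : Type*} [NormedAddCommGroup E]
    [NormedSpace ℂ E] {U : Set E} (hU : IsOpen U) (hUc : Convex ℝ U) {F : E → ℂ}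
    (hF : DifferentiableOn ℂ F U) {x₀ : E} (hx₀ : x₀ ∈ U) (hF₀ : F =ᶠ[𝓝 x₀] 0) :
    Set.EqOn F 0 U := by
  intro x hx
  let ℓ : ℂ → E := fun s => x₀ + s • (x - x₀)
  have hℓ : Differentiable ℂ ℓ := by fun_prop
  have hℓ₀ : ℓ 0 = x₀ := by simp [ℓ]
  have hℓ₁ : ℓ 1 = x := by simp [ℓ]
  have hpre : IsPreconnected (ℓ ⁻¹' U) := ((hUc.translate_preimage_right x₀).linear_preimage
    ((LinearMap.toSpanSingleton ℂ E (x - x₀)).restrictScalars ℝ)).isPreconnected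
  have hanalytic : AnalyticOnNhd ℂ (F ∘ ℓ) (ℓ ⁻¹' U) :=
    (hF.comp hℓ.differentiableOn (Set.mapsTo_preimage ℓ U)).analyticOnNhd
      (hU.preimage hℓ.continuous)
  have hzero : F ∘ ℓ =ᶠ[𝓝 0] 0 :=
    (hℓ.continuous.tendsto' 0 x₀ hℓ₀).eventually hF₀
  simpa [hℓ₁] using hanalytic.eqOn_zero_of_preconnected_of_eventuallyEq_zero hpre
    (by rwa [Set.mem_preimage, hℓ₀]) hzero (x := 1) (by rwa [Set.mem_preimage, hℓ₁])

theorem eqOn_zero_of_preconnected_of_eventuallyEq_zero {E : Type*} [NormedAddCommGroup E]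
    [NormedSpace ℂ E] {U : Set E} (hU : IsOpen U) (hUc : IsPreconnected U) {F : E → ℂ}
    (hF : DifferentiableOn ℂ F U) {x₀ : E} (hx₀ : x₀ ∈ U) (hF₀ : F =ᶠ[𝓝 x₀] 0) :
    Set.EqOn F 0 U := by
  have hsub : U ⊆ {x | F =ᶠ[𝓝 x] 0} := by
    refine hUc.subset_of_closure_inter_subset isOpen_setOfPred_eventually_nhds
      ⟨x₀, hx₀, hF₀⟩ ?_
    rintro x ⟨hx, hxU⟩
    obtain ⟨r, hr, hball⟩ := Metric.isOpen_iff.1 hU x hxU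
    obtain ⟨y, hy, hxy⟩ := Metric.mem_closure_iff.1 hx r hr
    exact (eqOn_zero_of_convex_of_eventuallyEq_zero Metric.isOpen_ball (convex_ball x r)
      (hF.mono hball) (Metric.mem_ball'.2 hxy) hy).eventuallyEq_of_mem (Metric.ball_mem_nhds x hr)
  exact fun x hx => (hsub hx).eq_of_nhds

theorem exists_eventuallyEq_mul_monomial (hΩ : IsOpen Ω) {F : (Fin n → ℂ) → ℂ}
    (hF : DifferentiableOn ℂ F Ω) {α : Fin n → ℤ}
    (hom : ∀ z ∈ Ω, ∀ t, F (rot t z) = mFourier α t * F z) {p : Fin n → ℂ} (hp : p ∈ Ω)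
    (hp₀ : p ∈ nonzeroCoords n) : ∃ c, F =ᶠ[𝓝 p] fun z => c * monomial α z := by
  obtain ⟨r, hr, hball⟩ := Metric.isOpen_iff.1 (hΩ.inter (isOpen_nonzeroCoords n)) p ⟨hp, hp₀⟩
  let G : (Fin n → ℂ) → ℂ := fun z => F z * monomial (-α) z
  have hG : ∀ z ∈ Metric.ball p r, DifferentiableAt ℂ G z := fun z hz =>
    (hF.differentiableAt (hΩ.mem_nhds (hball hz).1)).mul
      (analyticAt_monomial fun j => Or.inl ((hball hz).2 j)).differentiableAt
  have hG₀ : ∀ z ∈ Ω, ∀ t, G (rot t z) = mFourier 0 t * G z := fun z hz t => by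
    simp only [G, hom z hz, monomial_rot, mFourier_zero, ContinuousMap.one_apply]
    linear_combination F z * monomial (-α) z * mFourier_mul_mFourier_neg α t
  have hfderiv : ∀ z ∈ Metric.ball p r, fderiv ℂ G z = 0 := fun z hz => by
    refine ContinuousLinearMap.coe_injective (LinearMap.pi_ext' fun j => LinearMap.ext_ring ?_)
    have heuler := mul_pderiv_eq_of_forall_rot (hG z hz) (hG₀ z (hball hz).1) j
    rw [Pi.zero_apply, Int.cast_zero, zero_mul] at heuler
    exact (mul_eq_zero.1 heuler).resolve_left ((hball hz).2 j)
  obtain ⟨c, hc⟩ := Metric.isOpen_ball.exists_is_const_of_fderiv_eq_zero (𝕜 := ℂ)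
    (convex_ball p r).isPreconnected (fun z hz => (hG z hz).differentiableWithinAt) hfderiv
  refine ⟨c, ?_⟩
  filter_upwards [Metric.ball_mem_nhds p hr] with z hz
  rw [← hc z hz]
  linear_combination (-F z) * monomial_mul_monomial_neg α (hball hz).2

theorem exists_mul_monomial_negPart_eqOn (hΩ : IsOpen Ω) (hΩc : IsConnected Ω)
    {F : (Fin n → ℂ) → ℂ} (hF : DifferentiableOn ℂ F Ω) {α : Fin n → ℤ}
    (hom : ∀ z ∈ Ω, ∀ t, F (rot t z) = mFourier α t * F z) :
    ∃ c, ∀ z ∈ Ω, F z * monomial α⁻ z = c * monomial α⁺ z := by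
  obtain ⟨p, hp, hp₀⟩ := (dense_nonzeroCoords n).inter_open_nonempty Ω hΩ hΩc.nonempty
  obtain ⟨c, hc⟩ := exists_eventuallyEq_mul_monomial hΩ hF hom hp hp₀
  have hmonomial {β : Fin n → ℤ} (hβ : 0 ≤ β) : DifferentiableOn ℂ (monomial β) Ω := fun z _ =>
    (analyticAt_monomial fun j => Or.inr (hβ j)).differentiableAt.differentiableWithinAt
  -- With the negative powers cleared, the identity theorem applies on all of `Ω`, including where
  -- it meets the coordinate hyperplanes.
  have hzero : Set.EqOn (fun z => F z * monomial α⁻ z - c * monomial α⁺ z) 0 Ω := by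
    refine eqOn_zero_of_preconnected_of_eventuallyEq_zero hΩ hΩc.isPreconnected
      ((hF.mul (hmonomial (negPart_nonneg α))).sub
        ((hmonomial (posPart_nonneg α)).const_mul c)) hp ?_
    filter_upwards [hc, (isOpen_nonzeroCoords n).mem_nhds hp₀] with z hz hz₀
    rw [hz, mul_assoc, monomial_mul_monomial_negPart fun j => Or.inl (hz₀ j), sub_self,
      Pi.zero_apply]
  exact ⟨c, fun z hz => sub_eq_zero.1 (hzero hz)⟩

theorem ne_zero_or_nonneg_of_mul_monomial_negPart_eq (hΩ : IsOpen Ω) {F : (Fin n → ℂ) → ℂ}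
    {α : Fin n → ℤ} {c : ℂ} (hF : ∀ z ∈ Ω, F z * monomial α⁻ z = c * monomial α⁺ z) (hc : c ≠ 0)
    {z : Fin n → ℂ} (hz : z ∈ Ω) (j : Fin n) : z j ≠ 0 ∨ 0 ≤ α j := by
  by_contra! ⟨hzj, hαj⟩
  have hcont : Continuous fun w : Fin n → ℂ => Function.update w j 0 :=
    continuous_id.update j continuous_const
  obtain ⟨w, hw, hw₀⟩ := (dense_nonzeroCoords n).inter_open_nonempty _ (hΩ.preimage hcont)
    ⟨z, by rwa [Set.mem_preimage, ← hzj, Function.update_eq_self]⟩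
  have hneg : monomial α⁻ (Function.update w j 0) = 0 :=
    monomial_eq_zero (Function.update_self ..) (by simpa using hαj)
  have hpos : monomial α⁺ (Function.update w j 0) ≠ 0 := by
    refine monomial_ne_zero fun i => ?_
    obtain rfl | hij := eq_or_ne i j
    · exact Or.inr (by simpa using hαj.le)
    · exact Or.inl (by simpa [hij] using hw₀ i)
  have h := hF _ hw
  rw [hneg, mul_zero] at h
  exact mul_ne_zero hc hpos h.symm

theorem exists_eqOn_mul_monomial (hΩ : IsOpen Ω) (hΩc : IsConnected Ω)
    {F : (Fin n → ℂ) → ℂ} (hF : DifferentiableOn ℂ F Ω) {α : Fin n → ℤ}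
    (hom : ∀ z ∈ Ω, ∀ t, F (rot t z) = mFourier α t * F z) :
    ∃ c, Set.EqOn F (fun z => c * monomial α z) Ω ∧
      (c = 0 ∨ ∀ z ∈ Ω, ∀ j, z j ≠ 0 ∨ 0 ≤ α j) := by
  obtain ⟨c, hc⟩ := exists_mul_monomial_negPart_eqOn hΩ hΩc hF hom
  by_cases hc₀ : c = 0
  · obtain ⟨p, hp, hp₀⟩ := (dense_nonzeroCoords n).inter_open_nonempty Ω hΩ hΩc.nonempty
    have hFp : F =ᶠ[𝓝 p] 0 := by
      filter_upwards [hΩ.mem_nhds hp, (isOpen_nonzeroCoords n).mem_nhds hp₀] with z hz hz₀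
      have h := hc z hz
      rw [hc₀, zero_mul] at h
      exact (mul_eq_zero.1 h).resolve_right (monomial_ne_zero fun j => Or.inl (hz₀ j))
    refine ⟨0, fun z hz => ?_, Or.inl rfl⟩
    simpa using eqOn_zero_of_preconnected_of_eventuallyEq_zero hΩ hΩc.isPreconnected hF hp hFp hz
  · have hgood : ∀ z ∈ Ω, ∀ j, z j ≠ 0 ∨ 0 ≤ α j := fun z hz =>
      ne_zero_or_nonneg_of_mul_monomial_negPart_eq hΩ hc hc₀ hz
    refine ⟨c, fun z hz => ?_, Or.inr hgood⟩
    have hneg : monomial α⁻ z ≠ 0 := monomial_ne_zero fun j =>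
      (hgood z hz j).imp_right fun h => by simpa using h
    refine mul_right_cancel₀ hneg ?_
    rw [hc z hz, mul_assoc, monomial_mul_monomial_negPart (hgood z hz)]

/-! ### Decay of homogeneous components -/

theorem intCast_mul_torusCoeff (hΩ : IsOpen Ω) (hrot : ∀ t, Set.MapsTo (rot t) Ω Ω)
    {g : (Fin n → ℂ) → ℂ} (hg : AnalyticOnNhd ℂ g Ω) (α : Fin n → ℤ) (j : Fin n)
    {z : Fin n → ℂ} (hz : z ∈ Ω) :
    (α j : ℂ) * torusCoeff g α z = z j * torusCoeff (pderiv j g) (α - Pi.single j 1) z := by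
  rw [← pderiv_torusCoeff hΩ hrot hg α j hz]
  exact (mul_pderiv_eq_of_forall_rot ((differentiableOn_torusCoeff hΩ hrot hg α).differentiableAt
    (hΩ.mem_nhds hz)) (torusCoeff_rot g α z) j).symm

theorem one_add_norm_le_two_mul (α : Fin n → ℤ) (j : Fin n) :
    1 + ‖α‖ ≤ 2 * (1 + ‖α - Pi.single j 1‖) := by
  have htri := norm_le_norm_sub_add α (Pi.single j 1)
  have hsingle : ‖(Pi.single j 1 : Fin n → ℤ)‖ = 1 := by
    rw [Pi.norm_single, norm_one]
  linarith [norm_nonneg (α - Pi.single j 1)]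

theorem norm_le_sum_norm_apply {ι E : Type*} [Fintype ι] [SeminormedAddCommGroup E] (x : ι → E) :
    ‖x‖ ≤ ∑ j, ‖x j‖ :=
  (pi_norm_le_iff_of_nonneg (Finset.sum_nonneg fun _ _ => norm_nonneg _)).2 fun j =>
    Finset.single_le_sum (f := fun j => ‖x j‖) (fun _ _ => norm_nonneg _) (Finset.mem_univ j)

theorem norm_apply_mul_norm_torusCoeff_le (hΩ : IsOpen Ω) (hrot : ∀ t, Set.MapsTo (rot t) Ω Ω)
    {g : (Fin n → ℂ) → ℂ} (hg : AnalyticOnNhd ℂ g Ω) (α : Fin n → ℤ) (j : Fin n) (N m : ℕ)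
    {z : Fin n → ℂ} (hz : z ∈ Ω ∩ polydisc n m) :
    ‖α j‖ * ((1 + ‖α‖) ^ N * ‖torusCoeff g α z‖) ≤ 2 ^ N * m *
      ((1 + ‖α - Pi.single j 1‖) ^ N * ‖torusCoeff (pderiv j g) (α - Pi.single j 1) z‖) := by
  have heuler : ‖α j‖ * ‖torusCoeff g α z‖ ≤
      m * ‖torusCoeff (pderiv j g) (α - Pi.single j 1) z‖ := by
    have hnorm : ‖(α j : ℂ)‖ = ‖α j‖ := by rw [Complex.norm_intCast, Int.norm_eq_abs]
    rw [← hnorm, ← norm_mul, intCast_mul_torusCoeff hΩ hrot hg α j hz.1, norm_mul]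
    gcongr
    exact (hz.2 j).le
  calc ‖α j‖ * ((1 + ‖α‖) ^ N * ‖torusCoeff g α z‖)
      = (1 + ‖α‖) ^ N * (‖α j‖ * ‖torusCoeff g α z‖) := by ring
    _ ≤ (2 * (1 + ‖α - Pi.single j 1‖)) ^ N *
        (m * ‖torusCoeff (pderiv j g) (α - Pi.single j 1) z‖) := by
      gcongr
      exact one_add_norm_le_two_mul α j
    _ = _ := by
      rw [mul_pow]
      ring

theorem exists_one_add_norm_pow_mul_norm_torusCoeff_le (hΩ : IsOpen Ω)
    (hrot : ∀ t, Set.MapsTo (rot t) Ω Ω) {g : (Fin n → ℂ) → ℂ} (hg : AnalyticOnNhd ℂ g Ω) {m : ℕ}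
    (hbdd : ∀ β, ∃ C, ∀ z ∈ Ω ∩ polydisc n m, ‖mderiv β g z‖ ≤ C) (N : ℕ) (β : Fin n → ℕ) :
    ∃ C, ∀ α, ∀ z ∈ Ω ∩ polydisc n m, (1 + ‖α‖) ^ N * ‖torusCoeff (mderiv β g) α z‖ ≤ C := by
  induction N generalizing β with
  | zero =>
    obtain ⟨C, hC⟩ := hbdd β
    refine ⟨C, fun α z hz => ?_⟩
    rw [pow_zero, one_mul]
    exact norm_torusCoeff_le (fun t => hC _ ⟨hrot t hz.1, mapsTo_rot_polydisc t m hz.2⟩) α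
  | succ N ih =>
    obtain ⟨C₀, hC₀⟩ := ih β
    choose C hC using fun j => ih (β + Pi.single j 1)
    refine ⟨C₀ + ∑ j, 2 ^ N * m * C j, fun α z hz => ?_⟩
    have hcoord (j : Fin n) :
        ‖α j‖ * ((1 + ‖α‖) ^ N * ‖torusCoeff (mderiv β g) α z‖) ≤ 2 ^ N * m * C j := by
      refine (norm_apply_mul_norm_torusCoeff_le hΩ hrot (fun z hz => analyticAt_mderiv β (hg z hz))
        α j N m hz).trans ?_
      rw [torusCoeff_congr fun t => pderiv_mderiv hΩ β j hg (hrot t hz.1)]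
      gcongr
      exact hC j _ z hz
    calc (1 + ‖α‖) ^ (N + 1) * ‖torusCoeff (mderiv β g) α z‖
        = (1 + ‖α‖) * ((1 + ‖α‖) ^ N * ‖torusCoeff (mderiv β g) α z‖) := by ring
      _ ≤ (1 + ∑ j, ‖α j‖) * ((1 + ‖α‖) ^ N * ‖torusCoeff (mderiv β g) α z‖) := by
        gcongr
        exact norm_le_sum_norm_apply α
      _ = (1 + ‖α‖) ^ N * ‖torusCoeff (mderiv β g) α z‖ +
          ∑ j, ‖α j‖ * ((1 + ‖α‖) ^ N * ‖torusCoeff (mderiv β g) α z‖) := by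
        rw [add_mul, one_mul, Finset.sum_mul]
      _ ≤ C₀ + ∑ j, 2 ^ N * m * C j :=
        add_le_add (hC₀ α z hz) (Finset.sum_le_sum fun j _ => hcoord j)

theorem summable_one_add_norm_pow_inv (n : ℕ) :
    Summable fun α : Fin n → ℤ => ((1 + ‖α‖) ^ (n + 1))⁻¹ := by
  let b := (Pi.basisFun ℝ (Fin n)).restrictScalars ℤ
  have hnorm (α : Fin n → ℤ) : ‖b.equivFun.symm α‖ = ‖α‖ := by
    have hcoe : (b.equivFun.symm α : Fin n → ℝ) = fun j => (α j : ℝ) := by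
      ext j
      simp [b, Module.Basis.equivFun_symm_apply, Pi.single_apply]
    change ‖(b.equivFun.symm α : Fin n → ℝ)‖ = _
    rw [hcoe]
    rfl
  have hsum : Summable fun α : Fin n → ℤ => ‖α‖⁻¹ ^ (n + 1) := by
    simpa only [Function.comp_def, LinearEquiv.coe_toEquiv, hnorm] using
      (ZLattice.summable_norm_pow_inv _ (n + 1) (by simp [ZLattice.rank ℝ])).comp_injective
        b.equivFun.symm.injective
  refine hsum.of_norm_bounded_eventually ?_
  filter_upwards [(Set.finite_singleton (0 : Fin n → ℤ)).compl_mem_cofinite] with α hα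
  have : 0 < ‖α‖ := norm_pos_iff.2 hα
  rw [Real.norm_of_nonneg (by positivity), ← inv_pow]
  gcongr
  linarith

theorem exists_summable_norm_torusCoeff_mderiv_le (hΩ : IsOpen Ω)
    (hrot : ∀ t, Set.MapsTo (rot t) Ω Ω) {g : (Fin n → ℂ) → ℂ} (hg : AnalyticOnNhd ℂ g Ω) {m : ℕ}
    (hbdd : ∀ β, ∃ C, ∀ z ∈ Ω ∩ polydisc n m, ‖mderiv β g z‖ ≤ C) (β : Fin n → ℕ) :
    ∃ b : (Fin n → ℤ) → ℝ, Summable b ∧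
      ∀ α, ∀ z ∈ Ω ∩ polydisc n m, ‖torusCoeff (mderiv β g) α z‖ ≤ b α := by
  obtain ⟨C, hC⟩ :=
    exists_one_add_norm_pow_mul_norm_torusCoeff_le hΩ hrot hg hbdd (n + 1) β
  refine ⟨_, (summable_one_add_norm_pow_inv n).mul_right C, fun α z hz => ?_⟩
  rw [inv_mul_eq_div, le_div_iff₀' (by positivity)]
  exact hC α z hz

/-! ### Coefficients as torus integrals -/

open scoped Pointwise in
theorem integral_Icc_zero_two_pi {E : Type*} [NormedAddCommGroup E] [NormedSpace ℝ E]
    (Φ : (Fin n → ℝ) → E) :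
    ∫ θ in Set.Icc 0 fun _ => 2 * Real.pi, Φ θ = (2 * Real.pi) ^ n •
      ∫ x in {x : Fin n → ℝ | ∀ i, x i ∈ Set.Ioc (0 : ℝ) (0 + 1)}, Φ ((2 * Real.pi) • x) := by
  have hbox : (2 * Real.pi) • {x : Fin n → ℝ | ∀ i, x i ∈ Set.Ioc (0 : ℝ) (0 + 1)} =
      Set.univ.pi fun _ => Set.Ioc 0 (2 * Real.pi) := by
    ext x
    rw [Set.mem_smul_set_iff_inv_smul_mem₀ Real.two_pi_pos.ne']
    simp only [Set.mem_ofPred_eq, Set.mem_univ_pi, Pi.smul_apply, smul_eq_mul, Set.mem_Ioc,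
      inv_mul_le_iff₀ Real.two_pi_pos, zero_add, mul_one,
      mul_pos_iff_of_pos_left (inv_pos.2 Real.two_pi_pos)]
  have hae : (Set.univ.pi fun _ : Fin n => Set.Ioc 0 (2 * Real.pi)) =ᵐ[volume]
      Set.Icc (0 : Fin n → ℝ) fun _ => 2 * Real.pi := Measure.univ_pi_Ioc_ae_eq_Icc
  rw [Measure.setIntegral_comp_smul_of_pos volume Φ _ Real.two_pi_pos, hbox,
    setIntegral_congr_set hae, Module.finrank_fin_fun,
    smul_inv_smul₀ (pow_ne_zero n Real.two_pi_pos.ne')]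

theorem torusMap_zero_two_pi_smul (R x : Fin n → ℝ) :
    torusMap 0 R ((2 * Real.pi) • x) = rot (fun j => (x j : UnitAddCircle)) fun j => (R j : ℂ) := by
  ext j
  simp only [torusMap, Pi.zero_apply, zero_add, Pi.smul_apply, smul_eq_mul, rot_apply,
    fourier_coe_apply]
  rw [mul_comm]
  congr 2
  push_cast
  ring

theorem torusIntegral_zero_eq_integral_rot (h : (Fin n → ℂ) → ℂ) (R : Fin n → ℝ) :
    torusIntegral h 0 R = (2 * (Real.pi : ℂ) * Complex.I) ^ n * ∫ t : UnitAddTorus (Fin n),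
      (∏ j, rot t (fun j => (R j : ℂ)) j) * h (rot t fun j => (R j : ℂ)) := by
  let Φ (ζ : Fin n → ℂ) : ℂ := (∏ j, ζ j) * h ζ
  have hprod (θ : Fin n → ℝ) : (∏ j, (R j * Complex.exp (θ j * Complex.I) * Complex.I : ℂ)) •
      h (torusMap 0 R θ) = Complex.I ^ n * Φ (torusMap 0 R θ) := by
    rw [Finset.prod_mul_distrib, Finset.prod_const, Finset.card_univ, Fintype.card_fin]
    simp only [Φ, torusMap, Pi.zero_apply, zero_add, smul_eq_mul]
    ring
  have hpreimage := UnitAddTorus.integral_preimage (fun t => Φ (rot t fun j => (R j : ℂ))) 0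
  simp only [Pi.zero_apply] at hpreimage
  simp only [torusIntegral, hprod]
  rw [integral_Icc_zero_two_pi]
  simp only [torusMap_zero_two_pi_smul]
  rw [integral_const_mul, hpreimage, Complex.real_smul]
  push_cast
  ring

theorem ofReal_norm_mem_nonzeroCoords {w : Fin n → ℂ} (hw : w ∈ nonzeroCoords n) :
    (fun j => (‖w j‖ : ℂ)) ∈ nonzeroCoords n := fun j =>
  Complex.ofReal_ne_zero.2 (norm_ne_zero_iff.2 (hw j))

theorem IsReinhardtDomain.ofReal_norm_mem (hΩ : IsReinhardtDomain Ω) {w : Fin n → ℂ} (hw : w ∈ Ω)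
    (hw₀ : w ∈ nonzeroCoords n) : (fun j => (‖w j‖ : ℂ)) ∈ Ω := by
  have h := hΩ.rotate_mem w hw (fun j => ‖w j‖ / w j) fun j => by
    rw [norm_div, Complex.norm_real, norm_norm, div_self (norm_ne_zero_iff.2 (hw₀ j))]
  simpa only [div_mul_cancel₀ _ (hw₀ _)] using h

theorem prod_mul_div_prod_zpow_add_one (α : Fin n → ℤ) {ζ : Fin n → ℂ} (hζ : ζ ∈ nonzeroCoords n)
    (a : ℂ) : (∏ j, ζ j) * (a / ∏ j, ζ j ^ (α j + 1)) = monomial (-α) ζ * a := by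
  have hprod : ∏ j, ζ j ^ (α j + 1) = monomial α ζ * ∏ j, ζ j := by
    rw [monomial, ← Finset.prod_mul_distrib]
    exact Finset.prod_congr rfl fun j _ => zpow_add_one₀ (hζ j) _
  have hne : ∏ j, ζ j ≠ 0 := Finset.prod_ne_zero_iff.2 fun j _ => hζ j
  have hα : monomial α ζ ≠ 0 := monomial_ne_zero fun j => Or.inl (hζ j)
  rw [hprod, eq_inv_of_mul_eq_one_right (monomial_mul_monomial_neg α hζ)]
  field_simp

theorem laurentCoeff_eq_monomial_neg_mul_torusCoeff (f : Ω → ℂ) {w : Fin n → ℂ}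
    (hw : w ∈ nonzeroCoords n) (α : Fin n → ℤ) :
    laurentCoeff f w α =
      monomial (-α) (fun j => (‖w j‖ : ℂ)) * torusCoeff (zeroExt f) α fun j => (‖w j‖ : ℂ) := by
  have hint (t : UnitAddTorus (Fin n)) :
      (∏ j, rot t (fun j => (‖w j‖ : ℂ)) j) * (zeroExt f (rot t fun j => (‖w j‖ : ℂ)) /
          ∏ j, rot t (fun j => (‖w j‖ : ℂ)) j ^ (α j + 1)) =
        monomial (-α) (fun j => (‖w j‖ : ℂ)) *
          (mFourier (-α) t * zeroExt f (rot t fun j => (‖w j‖ : ℂ))) := by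
    rw [prod_mul_div_prod_zpow_add_one α
      (mapsTo_rot_nonzeroCoords t (ofReal_norm_mem_nonzeroCoords hw)), monomial_rot]
    ring
  rw [laurentCoeff, torusIntegral_zero_eq_integral_rot,
    inv_mul_cancel_left₀ (pow_ne_zero n Complex.two_pi_I_ne_zero), torusCoeff_eq_integral,
    ← integral_const_mul]
  simp only [hint]

/-! ### Convergence in `𝒜^∞(Ω)` -/

theorem summable_seminorm_of_withSeminorms {𝕜 E ι Γ : Type*} [NontriviallyNormedField 𝕜]
    [AddCommGroup E] [Module 𝕜 E] [TopologicalSpace E] {q : SeminormFamily 𝕜 E ι}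
    (hq : WithSeminorms q) {x : Γ → E} (hx : ∀ i, Summable fun a => q i (x a))
    {p : Seminorm 𝕜 E} (hp : Continuous p) : Summable fun a => p (x a) := by
  obtain ⟨s, C, -, hC⟩ := Seminorm.bound_of_continuous hq p hp
  refine Summable.of_nonneg_of_le (fun a => apply_nonneg p _) (fun a => ?_)
    ((summable_sum fun i (_ : i ∈ s) => hx i).mul_left (C : ℝ))
  calc p (x a) ≤ C * s.sup q (x a) := hC _
    _ ≤ C * ∑ i ∈ s, q i (x a) := by
      gcongr
      exact Seminorm.finset_sup_apply_le (Finset.sum_nonneg fun i _ => apply_nonneg _ _)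
        fun i hi => Finset.single_le_sum (f := fun i => q i (x a))
          (fun i _ => apply_nonneg _ _) hi

theorem norm_mderiv_le_ckSeminorm (f : AInfty Ω) {k m : ℕ} {β : Fin n → ℕ} (hβ : ∑ j, β j ≤ k)
    {z : Fin n → ℂ} (hz : z ∈ Ω ∩ polydisc n m) :
    ‖mderiv β (zeroExt f.toFun) z‖ ≤ ckSeminorm Ω k m f :=
  le_ciSup (bddAbove_ckNorm k m f) ⟨⟨β, hβ⟩, ⟨z, hz⟩⟩

theorem ckSeminorm_le {f : AInfty Ω} {k m : ℕ} {C : ℝ} (hC₀ : 0 ≤ C)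
    (hC : ∀ β : Fin n → ℕ, ∑ j, β j ≤ k → ∀ z ∈ Ω ∩ polydisc n m,
      ‖mderiv β (zeroExt f.toFun) z‖ ≤ C) : ckSeminorm Ω k m f ≤ C :=
  Real.iSup_le (fun p => hC p.1.1 p.1.2 p.2.1 p.2.2) hC₀

theorem summable_ckSeminorm {Γ : Type*} {x : Γ → AInfty Ω} {m : ℕ}
    (hx : ∀ β : Fin n → ℕ, ∃ b : Γ → ℝ, Summable b ∧
      ∀ a, ∀ z ∈ Ω ∩ polydisc n m, ‖mderiv β (zeroExt (x a).toFun) z‖ ≤ b a) (k : ℕ) :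
    Summable fun a => ckSeminorm Ω k m (x a) := by
  choose b hb hxb using hx
  refine Summable.of_nonneg_of_le (fun a => apply_nonneg _ _) (fun a => ?_)
    (summable_sum fun β (_ : β ∈ Finset.Iic fun _ : Fin n => k) => (hb β).abs)
  refine ckSeminorm_le (Finset.sum_nonneg fun β _ => abs_nonneg _) fun β hβ z hz => ?_
  have hβk : β ∈ Finset.Iic fun _ : Fin n => k := Finset.mem_Iic.2 fun j =>
    (Finset.single_le_sum (fun _ _ => Nat.zero_le _) (Finset.mem_univ j)).trans hβ
  calc ‖mderiv β (zeroExt (x a).toFun) z‖ ≤ |b β a| := (hxb β a z hz).trans (le_abs_self _)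
    _ ≤ _ := Finset.single_le_sum (f := fun β => |b β a|) (fun β _ => abs_nonneg _) hβk

/-- Evaluation of `D^β` at a point of `Ω`, as a linear map, to differentiate finite sums in
`𝒜^∞(Ω)`. -/
def mderivEval (β : Fin n → ℕ) (z : Ω) : AInfty Ω →ₗ[ℂ] ℂ where
  toFun f := mderiv β (zeroExt f.toFun) z
  map_add' f g := by
    rw [AInfty.toFun_add, zeroExt_add, mderiv_add _ (f.isAInfty.holo _ z.2) (g.isAInfty.holo _ z.2)]
  map_smul' a f := by
    rw [AInfty.toFun_smul, zeroExt_smul, mderiv_smul _ a (f.isAInfty.holo _ z.2)]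
    rfl

theorem hasSum_of_hasSum_mderiv {Γ : Type*} {x : Γ → AInfty Ω} {f : AInfty Ω}
    (hx : ∀ k m, Summable fun a => ckSeminorm Ω k m (x a))
    (hf : ∀ (β : Fin n → ℕ) (z : Ω), HasSum (fun a => mderivEval β z (x a)) (mderivEval β z f)) :
    HasSum x f := by
  refine ((withSeminorms_ckFamily Ω).tendsto_nhds _ f).2 ?_
  rintro ⟨k, m⟩ ε hε
  filter_upwards [(tendsto_tsum_compl_atTop_zero fun a => ckSeminorm Ω k m (x a)).eventually
    (gt_mem_nhds hε)] with s hs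
  refine lt_of_le_of_lt (ckSeminorm_le (tsum_nonneg fun _ => apply_nonneg _ _)
    fun β hβ z hz => ?_) hs
  have htail : mderivEval β ⟨z, hz.1⟩ (∑ a ∈ s, x a - f) =
      -∑' a : {a // a ∉ s}, mderivEval β ⟨z, hz.1⟩ (x a) := by
    have hsum := hf β ⟨z, hz.1⟩
    rw [map_sub, map_sum, ← hsum.tsum_eq, ← hsum.summable.sum_add_tsum_subtype_compl s,
      sub_add_cancel_left]
  calc ‖mderivEval β ⟨z, hz.1⟩ (∑ a ∈ s, x a - f)‖
      = ‖∑' a : {a // a ∉ s}, mderivEval β ⟨z, hz.1⟩ (x a)‖ := by rw [htail, norm_neg]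
    _ ≤ ∑' a : {a // a ∉ s}, ckSeminorm Ω k m (x a) :=
      tsum_of_norm_bounded ((hx k m).subtype _).hasSum fun a =>
        norm_mderiv_le_ckSeminorm (x a) hβ hz

/-! ### The Laurent series -/

theorem exists_torusCoeff_zeroExt_eqOn (hΩ : IsReinhardtDomain Ω) (f : AInfty Ω)
    (α : Fin n → ℤ) : ∃ c, Set.EqOn (torusCoeff (zeroExt f.toFun) α) (fun z => c * monomial α z) Ω ∧
      (c = 0 ∨ ∀ z ∈ Ω, ∀ j, z j ≠ 0 ∨ 0 ≤ α j) :=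
  exists_eqOn_mul_monomial hΩ.isOpen hΩ.isConnected
    (differentiableOn_torusCoeff hΩ.isOpen hΩ.mapsTo_rot f.isAInfty.holo α)
    fun z _ => torusCoeff_rot _ α z

theorem analyticOnNhd_torusCoeff_zeroExt (hΩ : IsReinhardtDomain Ω) (f : AInfty Ω)
    (α : Fin n → ℤ) : AnalyticOnNhd ℂ (torusCoeff (zeroExt f.toFun) α) Ω := by
  obtain ⟨c, hc, hgood⟩ := exists_torusCoeff_zeroExt_eqOn hΩ f α
  refine AnalyticOnNhd.congr hΩ.isOpen (fun z hz => ?_) hc.symm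
  obtain rfl | hgood := hgood
  · simpa only [zero_mul] using analyticAt_const
  · exact analyticAt_const.mul (analyticAt_monomial (hgood z hz))

theorem mderiv_zeroExt_torusCoeff (hΩ : IsReinhardtDomain Ω) (f : AInfty Ω) (α : Fin n → ℤ)
    (β : Fin n → ℕ) :
    Set.EqOn (mderiv β (zeroExt fun z : Ω => torusCoeff (zeroExt f.toFun) α z))
      (torusCoeff (mderiv β (zeroExt f.toFun)) (α - fun j => (β j : ℤ))) Ω :=
  (mderiv_eqOn hΩ.isOpen β (zeroExt_eqOn _)).trans
    (mderiv_torusCoeff hΩ.isOpen hΩ.mapsTo_rot f.isAInfty.holo α β)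

theorem isAInfty_torusCoeff (hΩ : IsReinhardtDomain Ω) (f : AInfty Ω) (α : Fin n → ℤ) :
    IsAInfty Ω fun z => torusCoeff (zeroExt f.toFun) α z where
  holo := (analyticOnNhd_torusCoeff_zeroExt hΩ f α).congr hΩ.isOpen (zeroExt_eqOn _).symm
  ext β := by
    obtain ⟨g, hg, hgf⟩ := f.isAInfty.ext β
    refine ⟨torusCoeff g (α - fun j => (β j : ℤ)), continuousOn_torusCoeff (fun t =>
      (hΩ.mapsTo_rot t).closure (rot t).continuous) hg _, fun z hz => ?_⟩
    rw [mderiv_zeroExt_torusCoeff hΩ f α β hz]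
    exact torusCoeff_congr (fun t => hgf _ (hΩ.mapsTo_rot t hz)) _

/-- The term of exponent `α` of the Laurent series of `f`, encoded as the homogeneous component of
`f` rather than as a multiple of `z ^ α`: its derivatives are then homogeneous components of the
derivatives of `f`. -/
def laurentTerm (hΩ : IsReinhardtDomain Ω) (f : AInfty Ω) (α : Fin n → ℤ) : AInfty Ω :=
  ⟨fun z => torusCoeff (zeroExt f.toFun) α z, isAInfty_torusCoeff hΩ f α⟩

theorem mderivEval_laurentTerm (hΩ : IsReinhardtDomain Ω) (f : AInfty Ω) (α : Fin n → ℤ)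
    (β : Fin n → ℕ) (z : Ω) : mderivEval β z (laurentTerm hΩ f α) =
      torusCoeff (mderiv β (zeroExt f.toFun)) (α - fun j => (β j : ℤ)) z :=
  mderiv_zeroExt_torusCoeff hΩ f α β z.2

theorem exists_laurentTerm_eq_mul_monomial (hΩ : IsReinhardtDomain Ω) (f : AInfty Ω)
    (α : Fin n → ℤ) : ∃ c, (∀ w ∈ Ω, w ∈ nonzeroCoords n → c = laurentCoeff f w α) ∧
      ∀ z : Ω, laurentTerm hΩ f α z = c * monomial α z := by
  obtain ⟨c, hc, -⟩ := exists_torusCoeff_zeroExt_eqOn hΩ f α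
  refine ⟨c, fun w hw hw₀ => ?_, fun z => hc z.2⟩
  rw [laurentCoeff_eq_monomial_neg_mul_torusCoeff f.toFun hw₀, hc (hΩ.ofReal_norm_mem hw hw₀)]
  linear_combination
    (-c) * monomial_mul_monomial_neg α (ofReal_norm_mem_nonzeroCoords hw₀)

theorem exists_summable_norm_torusCoeff_mderiv_zeroExt_le (hΩ : IsReinhardtDomain Ω) (f : AInfty Ω)
    (m : ℕ) (β : Fin n → ℕ) : ∃ b : (Fin n → ℤ) → ℝ, Summable b ∧ ∀ α, ∀ z ∈ Ω ∩ polydisc n m,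
      ‖torusCoeff (mderiv β (zeroExt f.toFun)) α z‖ ≤ b α :=
  exists_summable_norm_torusCoeff_mderiv_le hΩ.isOpen hΩ.mapsTo_rot f.isAInfty.holo
    (fun β => ⟨_, fun _ hz => norm_mderiv_le_ckSeminorm f (le_refl (∑ j, β j)) hz⟩) β

theorem summable_ckSeminorm_laurentTerm (hΩ : IsReinhardtDomain Ω) (f : AInfty Ω) (k m : ℕ) :
    Summable fun α => ckSeminorm Ω k m (laurentTerm hΩ f α) := by
  refine summable_ckSeminorm (fun β => ?_) k
  obtain ⟨b, hb, hfb⟩ := exists_summable_norm_torusCoeff_mderiv_zeroExt_le hΩ f m β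
  refine ⟨_, (Equiv.subRight fun j => (β j : ℤ)).summable_iff.2 hb, fun α z hz => ?_⟩
  exact (congrArg norm (mderivEval_laurentTerm hΩ f α β ⟨z, hz.1⟩)).trans_le (hfb _ z hz)

theorem hasSum_torusCoeff {g : (Fin n → ℂ) → ℂ} (hg : ContinuousOn g Ω)
    (hrot : ∀ t, Set.MapsTo (rot t) Ω Ω) {z : Fin n → ℂ} (hz : z ∈ Ω)
    (hsum : Summable fun α => torusCoeff g α z) : HasSum (fun α => torusCoeff g α z) (g z) := by
  let F : C(UnitAddTorus (Fin n), ℂ) := ⟨fun t => g (rot t z), continuousOn_univ.1 (hg.comp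
    (continuous_rot_apply.comp (Continuous.prodMk_right z)).continuousOn fun t _ => hrot t hz)⟩
  have hinv := hasSum_mFourier_series_apply_of_summable (f := F) hsum 0
  have hone (α : Fin n → ℤ) : mFourier α (0 : UnitAddTorus (Fin n)) = 1 := by simp [mFourier]
  simpa only [torusCoeff, hone, smul_eq_mul, mul_one, F, ContinuousMap.coe_mk, rot_zero] using hinv

theorem hasSum_mderivEval_laurentTerm (hΩ : IsReinhardtDomain Ω) (f : AInfty Ω) (β : Fin n → ℕ)
    (z : Ω) : HasSum (fun α => mderivEval β z (laurentTerm hΩ f α)) (mderivEval β z f) := by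
  obtain ⟨m, hm⟩ := exists_nat_gt ‖z.1‖
  obtain ⟨b, hb, hfb⟩ := exists_summable_norm_torusCoeff_mderiv_zeroExt_le hΩ f m β
  have hsum : Summable fun α => torusCoeff (mderiv β (zeroExt f.toFun)) α z :=
    hb.of_norm_bounded fun α => hfb α z ⟨z.2, fun j => (norm_le_pi_norm z.1 j).trans_lt hm⟩
  have hcont : ContinuousOn (mderiv β (zeroExt f.toFun)) Ω := fun w hw =>
    (analyticAt_mderiv β (f.isAInfty.holo w hw)).continuousAt.continuousWithinAt
  simp only [mderivEval_laurentTerm]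
  exact (Equiv.subRight fun j => (β j : ℤ)).hasSum_iff.2
    (hasSum_torusCoeff hcont hΩ.mapsTo_rot z.2 hsum)

theorem hasSum_laurentTerm (hΩ : IsReinhardtDomain Ω) (f : AInfty Ω) :
    HasSum (laurentTerm hΩ f) f :=
  hasSum_of_hasSum_mderiv (summable_ckSeminorm_laurentTerm hΩ f)
    (hasSum_mderivEval_laurentTerm hΩ f)

end LaurentAInfty

end

theorem theorem1 {n : ℕ} (hn : 1 ≤ n) (Ω : Set (Fin n → ℂ))
    (hΩ : LaurentAInfty.IsReinhardtDomain Ω) (f : LaurentAInfty.AInfty Ω) :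
    ∃ (c : (Fin n → ℤ) → ℂ) (x : (Fin n → ℤ) → LaurentAInfty.AInfty Ω),
      (∀ w ∈ Ω, (∀ j, w j ≠ 0) → ∀ α, c α = LaurentAInfty.laurentCoeff f w α) ∧
      (∀ α, ∀ z : Ω, x α z = c α * ∏ j, z.1 j ^ α j) ∧
      LaurentAInfty.AbsolutelyConvergent x ∧
      LaurentAInfty.UnconditionallyConvergesTo x f := by
  choose c hc hterm using LaurentAInfty.exists_laurentTerm_eq_mul_monomial hΩ f
  refine ⟨c, LaurentAInfty.laurentTerm hΩ f, fun w hw hw₀ α => hc α w hw hw₀, hterm, ?_, fun σ =>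
    (σ.hasSum_iff.2 (LaurentAInfty.hasSum_laurentTerm hΩ f)).tendsto_sum_nat⟩
  have : Nonempty (Fin n) := ⟨⟨0, hn⟩⟩
  obtain ⟨σ⟩ := nonempty_equiv_of_countable (α := ℕ) (β := Fin n → ℤ)
  exact ⟨σ, fun p hp => σ.summable_iff.2 (LaurentAInfty.summable_seminorm_of_withSeminorms
    (LaurentAInfty.withSeminorms_ckFamily Ω)
    (fun i => LaurentAInfty.summable_ckSeminorm_laurentTerm hΩ f i.1 i.2) hp)⟩
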